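/- For $x\in[0,1]$ let $x=\sum_{k\ge1}\alpha_k(x)3^{-k}$, $\alpha_k(x)\in\{0,1,2\}$, be its ternary representation, where for a number $x<1$ with two representations the one ending in $000\ldots$ is used (and $1=0.222\ldots_3$). Let $$\nu_i(x)=\lim_{n\to\infty}\frac{\#\{k\le n:\alpha_k(x)=i\}}{n}\quad(i=0,1,2),\qquad r(x)=\lim_{n\to\infty}\frac1n\sum_{k=1}^n\alpha_k(x),$$ whenever the limits exist, and let $$M_0=\{x\in[0,1]: r(x)\text{ and }\nu_0(x)\text{ exist and } r(x)=\nu_0(x)\}.$$ Then: 1. $M_0$ is exactly the set of all $x\in[0,1]$ for which $\nu_1(x)$ and $\nu_2(x)$ exist and $2\nu_1(x)+3\nu_2(x)=1$. 2. $M_0$ has the cardinality of the continuum. 3. $M_0$ is dense in $[0,1]$. 4. $M_0$ has Lebesgue measure zero. 5. The Besicovitch--Eggleston entropy ratio $$\frac{\ln\left(\tau_0^{\tau_0}\tau_1^{\tau_1}\tau_2^{\tau_2}\right)}{\ln\left((1/3)^{\tau_0}(1/3)^{\tau_1}(1/3)^{\tau_2}\right)}\qquad(0^0=1)$$ attains a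 maximum $D$ over all $\tau=(\tau_0,\tau_1,\tau_2)$ with $\tau_i\ge0$, $\tau_0+\tau_1+\tau_2=1$ and $2\tau_1+3\tau_2=1$; one has $0.8734<D<0.8735$, and the Hausdorff dimension of $M_0$ is at least $D$. In particular, the Hausdorff dimension of $M_0$ is at least $0.87$. -/

import Mathlib

open Set Filter Topology MeasureTheory

noncomputable section

namespace AsymptoticMean

/-- The ternary digits of `x ∈ [0, 1]`, with `digit x k` the `(k + 1)`-th digit: for `x < 1` it is
`⌊3 ^ (k + 1) * x⌋ mod 3`, i.e. the representation ending in `000…` is used for ternary rationals;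
the only ternary representation of `1` is `0.222…`. See `hasSum_digit` and `not_eventually_two`. -/
def digit (x : ℝ) (k : ℕ) : Fin 3 :=
  if x = 1 then 2 else Real.digits x 3 k

/-- The digits of `x ∈ [0, 1]` do represent `x`: `x = ∑ α_k 3 ^ (- k)`. -/
theorem hasSum_digit {x : ℝ} (hx : x ∈ Icc (0 : ℝ) 1) :
    HasSum (fun k => ((digit x k : ℕ) : ℝ) * ((3 : ℝ) ^ (k + 1))⁻¹) x := by
  by_cases h : x = 1
  · subst h
    have h2 : Real.ofDigits (fun _ : ℕ => (2 : Fin 3)) = 1 := Real.ofDigits_const_last_eq_one 2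
    have h3 := (Real.summable_ofDigitsTerm (digits := fun _ : ℕ => (2 : Fin 3))).hasSum
    rw [← Real.ofDigits, h2] at h3
    convert! h3 using 2 with k
    simp [digit, Real.ofDigitsTerm]
  · have h3 := Real.hasSum_ofDigitsTerm_digits x (b := 3) (by norm_num)
      ⟨hx.1, lt_of_le_of_ne hx.2 h⟩
    convert! h3 using 2 with k
    simp [digit, h, Real.ofDigitsTerm]

/-- For `x ∈ [0, 1)` the representation does not end in `222…`. -/
theorem not_eventually_two {x : ℝ} (hx : x ∈ Ico (0 : ℝ) 1) (N : ℕ) :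
    ¬ ∀ k, N ≤ k → digit x k = 2 := by
  intro H
  have hx1 : x ≠ 1 := ne_of_lt hx.2
  have h2 : Real.ofDigits (fun _ : ℕ => (2 : Fin 3)) = 1 := Real.ofDigits_const_last_eq_one 2
  have hs := Real.ofDigits_eq_sum_add_ofDigits (Real.digits x 3) N
  have ht : (fun i => Real.digits x 3 (i + N)) = fun _ : ℕ => (2 : Fin 3) := by
    funext i
    have := H (i + N) (by omega)
    simpa [digit, hx1] using this
  rw [Real.ofDigits_digits (by norm_num) hx, ht, h2, mul_one] at hs
  have hf := Real.ofDigits_digits_sum_eq (b := 3) hx N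
  have hl := Nat.lt_floor_add_one (((3 : ℕ) : ℝ) ^ N * x)
  rw [← hf] at hl
  have hp : (((3 : ℕ) : ℝ) ^ N) ≠ 0 := by positivity
  have : ((3 : ℕ) : ℝ) ^ N * x
      = ((3 : ℕ) : ℝ) ^ N * (∑ i ∈ Finset.range N, Real.ofDigitsTerm (Real.digits x 3) i) + 1 := by
    conv_lhs => rw [hs]
    rw [mul_add, mul_inv_cancel₀ hp]
  linarith

/-- `N_i(x, n)`: the number of occurrences of `i` among the first `n` ternary digits of `x`. -/
def digitCount (i : Fin 3) (x : ℝ) (n : ℕ) : ℕ :=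
  ((Finset.range n).filter fun k => digit x k = i).card

/-- The frequency `ν_i(x)` of the digit `i` in `x` exists and equals `t`. -/
def HasFreq (i : Fin 3) (x t : ℝ) : Prop :=
  Tendsto (fun n : ℕ => (digitCount i x n : ℝ) / (n : ℝ)) atTop (𝓝 t)

/-- The asymptotic mean of digits `r(x)` exists and equals `t`. -/
def HasMean (x t : ℝ) : Prop :=
  Tendsto (fun n : ℕ => (1 / (n : ℝ)) * ∑ k ∈ Finset.range n, ((digit x k : ℕ) : ℝ)) atTop (𝓝 t)

/-- The set of all `x ∈ [0, 1]` for which `r(x)` and `ν_0(x)` exist and are equal. -/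
def M₀ : Set ℝ :=
  {x | x ∈ Icc (0 : ℝ) 1 ∧ ∃ t : ℝ, HasMean x t ∧ HasFreq 0 x t}

/-- The ratio `ln (τ₀^τ₀ τ₁^τ₁ τ₂^τ₂) / ln (q₀^τ₀ q₁^τ₁ q₂^τ₂)` with `q₀ = q₁ = q₂ = 1/3`
(with the convention `0 ^ 0 = 1`, which is that of `Real.rpow`). -/
def entropyRatio (τ : Fin 3 → ℝ) : ℝ :=
  Real.log (∏ i, τ i ^ τ i) / Real.log (∏ i, (1 / 3 : ℝ) ^ τ i)

/-- The frequency vectors (probability vectors) `τ` with `2 τ₁ + 3 τ₂ = 1`. -/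
def freqLine : Set (Fin 3 → ℝ) :=
  {τ | (∀ i, 0 ≤ τ i) ∧ τ 0 + τ 1 + τ 2 = 1 ∧ 2 * τ 1 + 3 * τ 2 = 1}

end AsymptoticMean

end

/-!
Counting digits gives `r = ν₁ + 2 ν₂` and `ν₀ = 1 - ν₁ - ν₂`, so `r = ν₀` is the linear condition
`2 ν₁ + 3 ν₂ = 1` on the frequencies (`mem_M₀_iff`). Frequencies ignore finite blocks of digits, so
`M₀` is dense as soon as it is nonempty (`Icc_subset_closure_M₀`).

On `M₀` the frequency of the digit `0` is at least `1 / 2`. By Chernoff's bound, the proportion of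
words of length `20 m` with at least `9 m` zeros decays exponentially in `m`, so `M₀` is a
Lebesgue null set (`volume_M₀`).

For the dimension, let `τ` be a frequency vector on the line `2 τ₁ + 3 τ₂ = 1` and let the digits be
independent with law `τ`. By the strong law of large numbers almost every digit sequence has
frequencies `τ` (`ae_hasFreqs`) and so represents a point of `M₀`. For such a sequence the mass of
the cylinder of length `n` is the product of the weights of its digits, which is
`3 ^ (-n * (entropyRatio τ + o(1)))` (`HasFreqs.eventually_prod_le`). A set of diameter comparable
to `3 ^ (-n)` meets boundedly many triadic intervals of that length, so the mass distribution
principle (`hausdorffMeasure_ne_zero_of_cylinder_le`) gives `entropyRatio τ ≤ dimH M₀`. A set of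
positive dimension is uncountable, and `M₀` is Borel, so it has the cardinality of the continuum.

The entropy ratio is continuous on the compact set `freqLine`, so its maximum `D` exists. Its value
at `(7/12, 1/4, 1/6)` bounds `D` from below. Gibbs' inequality against weights proportional to
`1, z ^ 2, z ^ 3` bounds the entropy on the line by `log ((1 + z ^ 2 + z ^ 3) / z)` for every
`z > 0`, which bounds `D` from above.
-/

namespace AsymptoticMean

/-! ### Digit counts, frequencies and the mean -/

theorem digitCount_eq_sum (i : Fin 3) (x : ℝ) (n : ℕ) :
    (digitCount i x n : ℝ) = ∑ k ∈ Finset.range n, if digit x k = i then (1 : ℝ) else 0 := by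
  simp [digitCount]

theorem digitCount_add (x : ℝ) (n : ℕ) :
    (digitCount 0 x n : ℝ) + digitCount 1 x n + digitCount 2 x n = n := by
  simp only [digitCount_eq_sum, ← Finset.sum_add_distrib]
  calc _ = ∑ k ∈ Finset.range n, (1 : ℝ) := Finset.sum_congr rfl fun k _ => by
        generalize digit x k = d
        fin_cases d <;> simp
    _ = n := by simp

theorem sum_digit_eq (x : ℝ) (n : ℕ) :
    ∑ k ∈ Finset.range n, ((digit x k : ℕ) : ℝ) = digitCount 1 x n + 2 * digitCount 2 x n := by
  simp only [digitCount_eq_sum, Finset.mul_sum, ← Finset.sum_add_distrib]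
  refine Finset.sum_congr rfl fun k _ => ?_
  generalize digit x k = d
  fin_cases d <;> simp

theorem hasFreq_zero {x v₁ v₂ : ℝ} (h₁ : HasFreq 1 x v₁) (h₂ : HasFreq 2 x v₂) :
    HasFreq 0 x (1 - v₁ - v₂) := by
  refine ((tendsto_const_nhds.sub h₁).sub h₂).congr' ?_
  filter_upwards [eventually_gt_atTop 0] with n hn
  have hn' : (n : ℝ) ≠ 0 := by positivity
  rw [eq_div_iff hn', sub_mul, sub_mul, div_mul_cancel₀ _ hn', div_mul_cancel₀ _ hn']
  linarith [digitCount_add x n]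

theorem hasMean_of_hasFreq {x v₁ v₂ : ℝ} (h₁ : HasFreq 1 x v₁) (h₂ : HasFreq 2 x v₂) :
    HasMean x (v₁ + 2 * v₂) := by
  refine (h₁.add (h₂.const_mul 2)).congr fun n => ?_
  rw [sum_digit_eq]
  ring

/-- From `ν₀ = r = t` one recovers `ν₂ = r - (ν₁ + ν₂) = 2 t - 1` and `ν₁ = 2 - 3 t`. -/
theorem mem_M₀_iff {x : ℝ} : x ∈ M₀ ↔ x ∈ Icc (0 : ℝ) 1 ∧ ∃ v₁ v₂ : ℝ,
    HasFreq 1 x v₁ ∧ HasFreq 2 x v₂ ∧ 2 * v₁ + 3 * v₂ = 1 := by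
  refine and_congr_right fun _ => ⟨?_, ?_⟩
  · rintro ⟨t, hm, h0⟩
    have h2 : HasFreq 2 x (2 * t - 1) := by
      refine (((hm.add h0).sub_const 1).congr' ?_).trans (by rw [two_mul])
      filter_upwards [eventually_gt_atTop 0] with n hn
      have hn' : (n : ℝ) ≠ 0 := by positivity
      rw [sum_digit_eq]
      field_simp
      linarith [digitCount_add x n]
    have h1 : HasFreq 1 x (2 - 3 * t) := by
      have := hm.sub (h2.const_mul 2)
      refine (this.congr fun n => ?_).trans (by ring_nf; exact le_rfl)
      rw [sum_digit_eq]
      ring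
    exact ⟨_, _, h1, h2, by ring⟩
  · rintro ⟨v₁, v₂, h1, h2, h⟩
    refine ⟨v₁ + 2 * v₂, hasMean_of_hasFreq h1 h2, ?_⟩
    convert hasFreq_zero h1 h2 using 1
    linarith

theorem HasFreq.nonneg {i : Fin 3} {x t : ℝ} (h : HasFreq i x t) : 0 ≤ t :=
  ge_of_tendsto' h fun _ => by positivity

theorem one_notMem_M₀ : (1 : ℝ) ∉ M₀ := by
  rw [mem_M₀_iff]
  rintro ⟨-, v₁, v₂, h1, h2, h⟩
  have : HasFreq 2 1 1 := by
    refine tendsto_const_nhds.congr' ?_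
    filter_upwards [eventually_gt_atTop 0] with n hn
    have hn' : (n : ℝ) ≠ 0 := by positivity
    simp [digitCount, digit, hn']
  have e := tendsto_nhds_unique h2 this
  linarith [h1.nonneg]

theorem M₀_subset_Ico : M₀ ⊆ Ico (0 : ℝ) 1 := fun _ hx =>
  ⟨hx.1.1, lt_of_le_of_ne hx.1.2 fun h => one_notMem_M₀ (h ▸ hx)⟩

/-! ### Shifting digits and density -/

/-- The first `n` digits of `x` are those of the integer `⌊x * 3 ^ n⌋`. -/
theorem digits_eq_of_floor_eq {x y : ℝ} {n : ℕ}
    (h : ⌊x * (3 : ℝ) ^ n⌋₊ = ⌊y * (3 : ℝ) ^ n⌋₊) {k : ℕ} (hk : k < n) :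
    Real.digits x 3 k = Real.digits y 3 k := by
  obtain ⟨m, rfl⟩ : ∃ m, n = k + 1 + m := ⟨n - (k + 1), by omega⟩
  have key : ∀ z : ℝ, ⌊z * (3 : ℝ) ^ (k + 1)⌋₊ = ⌊z * (3 : ℝ) ^ (k + 1 + m)⌋₊ / 3 ^ m := by
    intro z
    rw [← Nat.floor_div_natCast]
    congr 1
    push_cast
    rw [pow_add _ (k + 1) m, ← mul_assoc, mul_div_cancel_right₀ _ (by positivity)]
  simp only [Real.digits, Nat.cast_ofNat]
  rw [key x, key y, h]

theorem digit_add_div_pow {x : ℝ} (hx : x ∈ Ico (0 : ℝ) 1) {n k : ℕ} (hk : k < 3 ^ n) (m : ℕ) :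
    digit ((k + x) / 3 ^ n) (m + n) = digit x m := by
  have hk' : (k : ℝ) + 1 ≤ 3 ^ n := by exact_mod_cast hk
  have h1 : ((k : ℝ) + x) / 3 ^ n ≠ 1 := by
    refine ne_of_lt ?_
    rw [div_lt_one (by positivity)]
    linarith [hx.2]
  rw [digit, digit, if_neg h1, if_neg hx.2.ne]
  have e : ((k : ℝ) + x) / 3 ^ n * ((3 : ℕ) : ℝ) ^ (m + n + 1)
      = x * ((3 : ℕ) : ℝ) ^ (m + 1) + ((k * 3 ^ (m + 1) : ℕ) : ℝ) := by
    push_cast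
    field_simp
    ring
  simp only [Real.digits, e]
  rw [Nat.floor_add_natCast (mul_nonneg hx.1 (by positivity))]
  ext
  simp [Nat.add_mod, Nat.mul_mod, Nat.pow_succ]

theorem hasFreq_add_div_pow {x : ℝ} (hx : x ∈ Ico (0 : ℝ) 1) {n k : ℕ} (hk : k < 3 ^ n)
    {i : Fin 3} {t : ℝ} (h : HasFreq i x t) : HasFreq i ((k + x) / 3 ^ n) t := by
  rw [HasFreq, ← tendsto_add_atTop_iff_nat n]
  set y := ((k : ℝ) + x) / 3 ^ n
  have hc : ∀ m : ℕ, (digitCount i y (m + n) : ℝ) = digitCount i y n + digitCount i x m := by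
    intro m
    rw [digitCount_eq_sum, digitCount_eq_sum, digitCount_eq_sum, add_comm m n,
      Finset.sum_range_add]
    congr 1
    refine Finset.sum_congr rfl fun j _ => ?_
    rw [add_comm n j, digit_add_div_pow hx hk]
  have l1 : Tendsto (fun m : ℕ => (digitCount i y n : ℝ) / ((m + n : ℕ) : ℝ)) atTop (𝓝 0) :=
    (tendsto_const_div_atTop_nhds_zero_nat _).comp (tendsto_add_atTop_nat n)
  have l2 := h.mul (tendsto_natCast_div_add_atTop (𝕜 := ℝ) (n : ℝ))
  have l3 := l1.add l2
  rw [mul_one, zero_add] at l3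
  refine l3.congr' ?_
  filter_upwards [eventually_gt_atTop 0] with m hm
  have hm' : (m : ℝ) ≠ 0 := by positivity
  have hmn : (m : ℝ) + n ≠ 0 := by positivity
  rw [hc]
  push_cast
  field_simp

/-- Frequencies ignore any finite block of digits, so `M₀` contains, with each of its points `x`,
all the points `(k + x) / 3 ^ n` obtained by putting a block in front of the digits of `x`. -/
theorem Icc_subset_closure_M₀ (hne : M₀.Nonempty) : Icc (0 : ℝ) 1 ⊆ closure M₀ := by
  obtain ⟨x, hx⟩ := hne
  have hx1 := M₀_subset_Ico hx
  rw [← closure_Ico (zero_ne_one (α := ℝ))]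
  refine closure_minimal ?_ isClosed_closure
  intro z hz
  rw [Metric.mem_closure_iff]
  intro ε hε
  obtain ⟨n, hn⟩ := exists_pow_lt_of_lt_one hε (show (1 / 3 : ℝ) < 1 by norm_num)
  have hp : (0 : ℝ) < 3 ^ n := by positivity
  have hk : ⌊z * (3 : ℝ) ^ n⌋₊ < 3 ^ n := by
    rw [Nat.floor_lt (mul_nonneg hz.1 hp.le)]
    push_cast
    exact mul_lt_of_lt_one_left hp hz.2
  set k := ⌊z * (3 : ℝ) ^ n⌋₊
  have hk1 : (k : ℝ) ≤ z * 3 ^ n := Nat.floor_le (mul_nonneg hz.1 hp.le)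
  have hk2 : z * 3 ^ n < k + 1 := Nat.lt_floor_add_one _
  have hk3 : (k : ℝ) + 1 ≤ 3 ^ n := by exact_mod_cast hk
  refine ⟨((k : ℝ) + x) / 3 ^ n, ?_, lt_of_le_of_lt ?_ hn⟩
  · obtain ⟨-, v₁, v₂, h1, h2, h⟩ := mem_M₀_iff.1 hx
    refine mem_M₀_iff.2 ⟨⟨?_, ?_⟩, v₁, v₂, hasFreq_add_div_pow hx1 hk h1,
      hasFreq_add_div_pow hx1 hk h2, h⟩
    · exact div_nonneg (add_nonneg (by positivity) hx1.1) hp.le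
    · rw [div_le_one hp]
      linarith [hx1.2]
  · have e : z - (k + x) / 3 ^ n = (z * 3 ^ n - k - x) / 3 ^ n := by
      field_simp
      ring
    rw [Real.dist_eq, e, abs_div, abs_of_pos hp, one_div_pow]
    gcongr
    rw [abs_le]
    constructor <;> linarith [hx1.1, hx1.2]

/-! ### Measurability and cardinality -/

theorem measurable_digit (k : ℕ) : Measurable fun x => digit x k := by
  unfold digit Real.digits
  refine Measurable.ite (measurableSet_eq) measurable_const ?_
  exact (measurable_of_countable (Fin.ofNat 3)).comp
    (Nat.measurable_floor.comp (measurable_id.mul_const _))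

theorem measurableSet_M₀ : MeasurableSet M₀ := by
  have hm : ∀ n : ℕ, Measurable fun x : ℝ =>
      (1 / (n : ℝ)) * ∑ k ∈ Finset.range n, ((digit x k : ℕ) : ℝ) := by
    intro n
    refine Measurable.const_mul (Finset.measurable_sum _ fun k _ => ?_) _
    exact (measurable_of_countable fun d : Fin 3 => ((d : ℕ) : ℝ)).comp (measurable_digit k)
  have hf : ∀ n : ℕ, Measurable fun x : ℝ => (digitCount 0 x n : ℝ) / (n : ℝ) := by
    intro n
    simp only [digitCount_eq_sum]
    refine Measurable.div_const (Finset.measurable_sum _ fun k _ => ?_) _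
    exact (measurable_of_countable fun d : Fin 3 => if d = 0 then (1 : ℝ) else 0).comp
      (measurable_digit k)
  -- `r` and `ν₀` exist jointly, and the difference of the two averages tends to `0`
  have e : M₀ = Icc 0 1 ∩ {x | ∃ p : ℝ × ℝ, Tendsto (fun n : ℕ =>
      ((1 / (n : ℝ)) * ∑ k ∈ Finset.range n, ((digit x k : ℕ) : ℝ),
        (digitCount 0 x n : ℝ) / (n : ℝ))) atTop (𝓝 p)} ∩
      {x | Tendsto (fun n : ℕ => (1 / (n : ℝ)) * ∑ k ∈ Finset.range n, ((digit x k : ℕ) : ℝ)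
        - (digitCount 0 x n : ℝ) / (n : ℝ)) atTop (𝓝 0)} := by
    ext x
    constructor
    · rintro ⟨h, t, h1, h2⟩
      exact ⟨⟨h, (t, t), h1.prodMk_nhds h2⟩, by simpa using h1.sub h2⟩
    · rintro ⟨⟨h, ⟨s, t⟩, h1⟩, h2⟩
      have hs := (continuous_fst.tendsto _).comp h1
      have ht := (continuous_snd.tendsto _).comp h1
      have : s = t := sub_eq_zero.1 (tendsto_nhds_unique (hs.sub ht) h2)
      exact ⟨h, t, this ▸ hs, ht⟩
  rw [e]
  refine (measurableSet_Icc.inter (measurableSet_exists_tendsto fun n => (hm n).prodMk (hf n))).inter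
    ?_
  exact measurableSet_tendsto (𝓝 0) fun n => (hm n).sub (hf n)

/-- By the Borel isomorphism theorem, an uncountable Borel set is isomorphic to `ℝ`. -/
theorem mk_eq_continuum_of_not_countable {s : Set ℝ} (hs : MeasurableSet s) (h : ¬ s.Countable) :
    Cardinal.mk s = Cardinal.continuum := by
  have := hs.standardBorel
  have e : s ≃ᵐ ℝ := PolishSpace.measurableEquivOfNotCountable h
    (by simp)
  rw [Cardinal.mk_congr e.toEquiv, Cardinal.mk_real]

/-! ### Lebesgue measure -/

/-- Chernoff's bound: weighting each word with `2` to the number of its zeros. -/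
theorem card_words_mul_two_pow_le (n a : ℕ) :
    (Finset.univ.filter fun w : Fin n → Fin 3 =>
      a ≤ (Finset.univ.filter fun k => w k = 0).card).card * 2 ^ a ≤ 4 ^ n := by
  have h4 : (4 : ℕ) ^ n = ∑ w : Fin n → Fin 3, ∏ k, if w k = 0 then 2 else 1 := by
    rw [← Fintype.sum_pow (fun d : Fin 3 => if d = 0 then 2 else 1) n]
    simp [Fin.sum_univ_three]
  rw [h4, ← smul_eq_mul]
  refine (Finset.card_nsmul_le_sum _ (fun w => ∏ k, if w k = 0 then 2 else 1) _ fun w hw => ?_).trans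
    (Finset.sum_le_sum_of_subset (Finset.filter_subset _ _))
  rw [Finset.prod_ite, Finset.prod_const, Finset.prod_const_one, mul_one]
  exact Nat.pow_le_pow_right two_pos (Finset.mem_filter.1 hw).2

theorem volume_setOf_digits_eq_le {n : ℕ} (w : Fin n → Fin 3) :
    volume {x | x ∈ Ico (0 : ℝ) 1 ∧ ∀ k : Fin n, digit x k = w k} ≤
      ENNReal.ofReal ((3 : ℝ) ^ n)⁻¹ := by
  refine (Real.volume_le_diam _).trans (Metric.ediam_le ?_)
  rintro x ⟨hx, hxw⟩ y ⟨hy, hyw⟩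
  rw [edist_dist, Real.dist_eq]
  refine ENNReal.ofReal_le_ofReal ?_
  have hd : ∀ k < n, Real.digits x 3 k = Real.digits y 3 k := by
    intro k hk
    have := (hxw ⟨k, hk⟩).trans (hyw ⟨k, hk⟩).symm
    simpa [digit, hx.2.ne, hy.2.ne] using this
  have := Real.abs_ofDigits_sub_ofDigits_le hd
  rw [Real.ofDigits_digits (by norm_num) hx, Real.ofDigits_digits (by norm_num) hy] at this
  simpa using this

theorem volume_setOf_many_zeros_le (n a : ℕ) :
    volume {x | x ∈ Ico (0 : ℝ) 1 ∧ a ≤ digitCount 0 x n} ≤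
      ENNReal.ofReal (4 ^ n / 2 ^ a * ((3 : ℝ) ^ n)⁻¹) := by
  set B := Finset.univ.filter fun w : Fin n → Fin 3 =>
      a ≤ (Finset.univ.filter fun k => w k = 0).card with hB
  have hsub : {x | x ∈ Ico (0 : ℝ) 1 ∧ a ≤ digitCount 0 x n} ⊆
      ⋃ w ∈ B, {x | x ∈ Ico (0 : ℝ) 1 ∧ ∀ k : Fin n, digit x k = w k} := by
    rintro x ⟨hx, ha⟩
    simp only [mem_iUnion]
    refine ⟨fun k => digit x k, ?_, hx, fun _ => rfl⟩
    rw [hB, Finset.mem_filter]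
    refine ⟨Finset.mem_univ _, ha.trans_eq ?_⟩
    rw [digitCount, Finset.card_filter, Finset.card_filter, Finset.sum_range]
  refine (measure_mono hsub).trans ((measure_biUnion_finset_le _ _).trans ?_)
  refine (Finset.sum_le_sum fun w _ => volume_setOf_digits_eq_le w).trans ?_
  rw [Finset.sum_const, ← ENNReal.ofReal_nsmul, nsmul_eq_mul]
  refine ENNReal.ofReal_le_ofReal (mul_le_mul_of_nonneg_right ?_ (by positivity))
  rw [le_div_iff₀ (by positivity)]
  exact_mod_cast card_words_mul_two_pow_le n a

/-- On `M₀` one has `ν₀ = (1 + ν₂) / 2 ≥ 1 / 2`, so at least `9 / 20` of the first `n` digits vanish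
once `n` is large. -/
theorem eventually_many_zeros {x : ℝ} (hx : x ∈ M₀) :
    ∀ᶠ m : ℕ in atTop, 9 * m ≤ digitCount 0 x (20 * m) := by
  obtain ⟨-, v₁, v₂, h1, h2, h⟩ := mem_M₀_iff.1 hx
  have h0 := hasFreq_zero h1 h2
  have hlt : (9 / 20 : ℝ) < 1 - v₁ - v₂ := by linarith [h2.nonneg]
  have ht : Tendsto (fun m : ℕ => 20 * m) atTop atTop :=
    tendsto_id.const_mul_atTop' (by norm_num)
  filter_upwards [ht.eventually (h0.eventually_const_lt hlt), eventually_gt_atTop 0] with m hm h0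
  rw [lt_div_iff₀ (by positivity)] at hm
  push_cast at hm
  have : (9 * m : ℝ) ≤ digitCount 0 x (20 * m) := by linarith
  exact_mod_cast this

theorem volume_M₀ : volume M₀ = 0 := by
  have hsub : M₀ ⊆ ⋃ N : ℕ, ⋂ m ≥ N,
      {x | x ∈ Ico (0 : ℝ) 1 ∧ 9 * m ≤ digitCount 0 x (20 * m)} := by
    intro x hx
    obtain ⟨N, hN⟩ := eventually_atTop.1 (eventually_many_zeros hx)
    simp only [mem_iUnion, mem_iInter]
    exact ⟨N, fun m hm => ⟨M₀_subset_Ico hx, hN m hm⟩⟩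
  refine measure_mono_null hsub (measure_iUnion_null fun N => ?_)
  -- the bound is `q ^ m` with `q = 4 ^ 20 / (2 ^ 9 * 3 ^ 20) < 1`
  have hq : Tendsto (fun m : ℕ => ENNReal.ofReal ((2 ^ 31 / 3 ^ 20 : ℝ) ^ m)) atTop (𝓝 0) := by
    rw [← ENNReal.ofReal_zero]
    exact ENNReal.tendsto_ofReal
      (tendsto_pow_atTop_nhds_zero_of_lt_one (by positivity) (by norm_num))
  refine le_antisymm (ge_of_tendsto hq ?_) zero_le
  filter_upwards [eventually_ge_atTop N] with m hm
  refine (measure_mono (iInter₂_subset m hm)).trans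
    ((volume_setOf_many_zeros_le (20 * m) (9 * m)).trans_eq ?_)
  congr 1
  rw [pow_mul, pow_mul, pow_mul, ← div_eq_mul_inv, ← div_pow, ← div_pow]
  norm_num

/-! ### Numbers with a prescribed digit sequence -/

/-- Compare termwise with `0.222… = 1`. -/
theorem ofDigits_lt_one {a : ℕ → Fin 3} (h : ∃ k, a k ≠ 2) : Real.ofDigits a < 1 := by
  obtain ⟨k, hk⟩ := h
  have h1 : Real.ofDigits (fun _ : ℕ => (2 : Fin 3)) = 1 := Real.ofDigits_const_last_eq_one 2
  rw [← h1]
  have hle : ∀ d : Fin 3, ((d : ℕ) : ℝ) ≤ ((2 : Fin 3) : ℕ) := fun d => by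
    fin_cases d <;> norm_num
  have hlt : ((a k : ℕ) : ℝ) < ((2 : Fin 3) : ℕ) := by
    refine lt_of_le_of_ne (hle _) fun e => hk (Fin.ext (by exact_mod_cast e))
  refine Summable.tsum_lt_tsum (i := k) (fun i => ?_) ?_ Real.summable_ofDigitsTerm
    Real.summable_ofDigitsTerm
  · exact mul_le_mul_of_nonneg_right (hle _) (by positivity)
  · exact mul_lt_mul_of_pos_right hlt (by positivity)

theorem exists_nat_pow_mul_sum (a : ℕ → Fin 3) (n : ℕ) :
    ∃ K : ℕ, (3 : ℝ) ^ n * ∑ i ∈ Finset.range n, Real.ofDigitsTerm a i = K := by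
  induction n with
  | zero => exact ⟨0, by simp⟩
  | succ n ih =>
    obtain ⟨K, hK⟩ := ih
    refine ⟨3 * K + a n, ?_⟩
    rw [Finset.sum_range_succ, mul_add, pow_succ, mul_right_comm, hK, Real.ofDigitsTerm]
    push_cast
    field_simp
    ring

/-- A sequence that does not end in `222…` is the digit sequence of the number it represents. -/
theorem digits_ofDigits {a : ℕ → Fin 3} (h : ∀ N, ∃ k, N ≤ k ∧ a k ≠ 2) :
    Real.digits (Real.ofDigits a) 3 = a := by
  funext n
  obtain ⟨K, hK⟩ := exists_nat_pow_mul_sum a n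
  have hr : Real.ofDigits (fun i => a (i + (n + 1))) < 1 := by
    obtain ⟨k, hk, hk2⟩ := h (n + 1)
    exact ofDigits_lt_one ⟨k - (n + 1), by rwa [Nat.sub_add_cancel hk]⟩
  have hr0 := Real.ofDigits_nonneg (fun i => a (i + (n + 1)))
  have e : Real.ofDigits a * ((3 : ℕ) : ℝ) ^ (n + 1) =
      ((3 * K + a n : ℕ) : ℝ) + Real.ofDigits (fun i => a (i + (n + 1))) := by
    rw [Real.ofDigits_eq_sum_add_ofDigits a (n + 1), Finset.sum_range_succ, Real.ofDigitsTerm]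
    push_cast
    rw [← hK]
    field_simp
    ring
  simp only [Real.digits, e]
  rw [add_comm, Nat.floor_add_natCast hr0, Nat.floor_eq_zero.2 hr, zero_add]
  ext
  simp [Nat.add_mod, Nat.mod_eq_of_lt (a n).2]

theorem digit_ofDigits {a : ℕ → Fin 3} (h : ∀ N, ∃ k, N ≤ k ∧ a k ≠ 2) (k : ℕ) :
    digit (Real.ofDigits a) k = a k := by
  obtain ⟨j, -, hj⟩ := h 0
  rw [digit, if_neg (ofDigits_lt_one ⟨j, hj⟩).ne, digits_ofDigits h]

/-! ### Bernoulli measures -/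

/-- The distribution on the digits `{0, 1, 2}` with weights `τ`. -/
noncomputable def digitLaw (τ : Fin 3 → ℝ) : Measure (Fin 3) :=
  ∑ i, ENNReal.ofReal (τ i) • Measure.dirac i

theorem digitLaw_singleton (τ : Fin 3 → ℝ) (i : Fin 3) :
    digitLaw τ {i} = ENNReal.ofReal (τ i) := by
  simp only [digitLaw, Measure.finsetSum_apply, Measure.smul_apply, smul_eq_mul]
  rw [Finset.sum_eq_single i]
  · simp
  · intro j _ hj
    simp [hj]
  · simp

theorem isProbabilityMeasure_digitLaw {τ : Fin 3 → ℝ} (h0 : ∀ i, 0 ≤ τ i)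
    (h1 : τ 0 + τ 1 + τ 2 = 1) : IsProbabilityMeasure (digitLaw τ) := by
  constructor
  simp only [digitLaw, Measure.finsetSum_apply, Measure.smul_apply, smul_eq_mul, measure_univ,
    mul_one]
  rw [← ENNReal.ofReal_sum_of_nonneg fun i _ => h0 i, Fin.sum_univ_three, h1, ENNReal.ofReal_one]

/-- The Bernoulli measure: the digits are independent with law `digitLaw τ`. -/
noncomputable def bernoulli (τ : Fin 3 → ℝ) : Measure (ℕ → Fin 3) :=
  Measure.infinitePi fun _ => digitLaw τ

theorem bernoulli_cylinder {τ : Fin 3 → ℝ} [IsProbabilityMeasure (digitLaw τ)]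
    (h0 : ∀ i, 0 ≤ τ i) (w : ℕ → Fin 3) (n : ℕ) :
    bernoulli τ {ω | ∀ k < n, ω k = w k} =
      ENNReal.ofReal (∏ k ∈ Finset.range n, τ (w k)) := by
  have e : {ω : ℕ → Fin 3 | ∀ k < n, ω k = w k} =
      Set.pi (Finset.range n : Set ℕ) fun k => {w k} := by
    ext ω
    simp [Set.mem_pi]
  rw [e, bernoulli, Measure.infinitePi_pi _ fun _ _ => MeasurableSet.singleton _,
    ENNReal.ofReal_prod_of_nonneg fun i _ => h0 _]
  exact Finset.prod_congr rfl fun k _ => digitLaw_singleton _ _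

/-- The frequency of each digit `i` in the sequence `ω` is `τ i`. -/
def HasFreqs (τ : Fin 3 → ℝ) (ω : ℕ → Fin 3) : Prop :=
  ∀ i, Tendsto (fun n : ℕ => (∑ k ∈ Finset.range n, if ω k = i then (1 : ℝ) else 0) / n)
    atTop (𝓝 (τ i))

/-- The strong law of large numbers for the indicators of the events `ω k = i`. -/
theorem ae_hasFreqs {τ : Fin 3 → ℝ} [IsProbabilityMeasure (digitLaw τ)] (h0 : ∀ i, 0 ≤ τ i) :
    ∀ᵐ ω ∂bernoulli τ, HasFreqs τ ω := by
  have : IsProbabilityMeasure (bernoulli τ) := by unfold bernoulli; infer_instance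
  simp only [HasFreqs]
  rw [ae_all_iff]
  intro i
  set f : Fin 3 → ℝ := fun d => if d = i then 1 else 0 with hf
  have hfm : Measurable f := measurable_of_countable f
  have hid : ∀ k : ℕ, MeasurePreserving (Function.eval k) (bernoulli τ) (digitLaw τ) := fun k =>
    measurePreserving_eval_infinitePi _ k
  have hmean : ∫ ω, f (ω 0) ∂bernoulli τ = τ i := by
    have e1 : ∫ ω, f (ω 0) ∂bernoulli τ = ∫ d, f d ∂digitLaw τ := by
      rw [← (hid 0).map_eq, integral_map (hid 0).measurable.aemeasurable
        hfm.aestronglyMeasurable]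
    have e2 : f = Set.indicator {i} 1 := by
      funext d
      simp [hf, Set.indicator_apply]
    rw [e1, e2, integral_indicator_one (MeasurableSet.singleton i), Measure.real,
      digitLaw_singleton, ENNReal.toReal_ofReal (h0 i)]
  have hind : ProbabilityTheory.iIndepFun (fun (k : ℕ) (ω : ℕ → Fin 3) => f (ω k))
      (bernoulli τ) := ProbabilityTheory.iIndepFun_infinitePi fun _ => hfm
  have := ProbabilityTheory.strong_law_ae_real (μ := bernoulli τ)
    (fun (k : ℕ) (ω : ℕ → Fin 3) => f (ω k)) ?_ (fun j k hjk => hind.indepFun hjk) ?_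
  · rw [hmean] at this
    exact this
  · refine Integrable.of_bound (hfm.comp (measurable_pi_apply 0)).aestronglyMeasurable 1 ?_
    refine Eventually.of_forall fun ω => ?_
    simp only [hf]
    split_ifs <;> simp
  · intro k
    exact ⟨(hfm.comp (measurable_pi_apply k)).aemeasurable,
      (hfm.comp (measurable_pi_apply 0)).aemeasurable, by
      have e : ∀ j : ℕ, Measure.map (fun ω : ℕ → Fin 3 => f (ω j)) (bernoulli τ) =
          Measure.map f (digitLaw τ) := fun j => by
        rw [← (hid j).map_eq, Measure.map_map hfm (hid j).measurable]
        rfl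
      rw [e, e]⟩

/-- If the digits were all `2` from some place on, the digit `0` would have frequency `0`. -/
theorem HasFreqs.exists_ne_two {τ : Fin 3 → ℝ} {ω : ℕ → Fin 3} (h : HasFreqs τ ω)
    (hτ : 0 < τ 0) (N : ℕ) : ∃ k, N ≤ k ∧ ω k ≠ 2 := by
  by_contra! H
  have hz : Tendsto (fun n : ℕ => (∑ k ∈ Finset.range n, if ω k = 0 then (1 : ℝ) else 0) / n)
      atTop (𝓝 0) := by
    refine (tendsto_const_div_atTop_nhds_zero_nat
      (∑ k ∈ Finset.range N, if ω k = 0 then (1 : ℝ) else 0)).congr' ?_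
    filter_upwards [eventually_ge_atTop N] with n hn
    congr 1
    refine Finset.sum_subset (Finset.range_mono hn) fun k _ hk => ?_
    rw [H k (by simpa using hk)]
    simp
  exact hτ.ne' (tendsto_nhds_unique (h 0) hz)

theorem pos_of_mem_freqLine {τ : Fin 3 → ℝ} (hτ : τ ∈ freqLine) : 0 < τ 0 := by
  obtain ⟨h0, h1, h2⟩ := hτ
  linarith [h0 1, h0 2]

theorem HasFreqs.ofDigits_mem_M₀ {τ : Fin 3 → ℝ} {ω : ℕ → Fin 3} (h : HasFreqs τ ω)
    (hτ : τ ∈ freqLine) : Real.ofDigits ω ∈ M₀ := by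
  have hf : ∀ i, HasFreq i (Real.ofDigits ω) (τ i) := fun i => by
    refine (h i).congr fun n => ?_
    rw [digitCount_eq_sum]
    simp only [digit_ofDigits (h.exists_ne_two (pos_of_mem_freqLine hτ))]
  exact mem_M₀_iff.2 ⟨⟨Real.ofDigits_nonneg _, Real.ofDigits_le_one _⟩, _, _, hf 1, hf 2, hτ.2.2⟩

/-! ### Entropy and the mass distribution principle -/

theorem entropyRatio_eq {τ : Fin 3 → ℝ} (h0 : ∀ i, 0 ≤ τ i) (h1 : τ 0 + τ 1 + τ 2 = 1) :
    entropyRatio τ = (∑ i, Real.negMulLog (τ i)) / Real.log 3 := by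
  have hpos : ∀ i, τ i ^ τ i ≠ 0 := fun i => by
    rcases (h0 i).eq_or_lt with h | h
    · simp [← h]
    · exact (Real.rpow_pos_of_pos h _).ne'
  have e1 : Real.log (∏ i, τ i ^ τ i) = -∑ i, Real.negMulLog (τ i) := by
    rw [Real.log_prod fun i _ => hpos i, ← Finset.sum_neg_distrib]
    refine Finset.sum_congr rfl fun i _ => ?_
    rcases (h0 i).eq_or_lt with h | h
    · simp [← h]
    · rw [Real.log_rpow h, Real.negMulLog]
      ring
  have e2 : Real.log (∏ i, (1 / 3 : ℝ) ^ τ i) = -Real.log 3 := by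
    rw [← Real.rpow_sum_of_pos (by norm_num), Fin.sum_univ_three, h1, Real.rpow_one, one_div,
      Real.log_inv]
  rw [entropyRatio, e1, e2, neg_div_neg_eq]

/-- The local dimension of the Bernoulli measure at a sequence with frequencies `τ` is the entropy
ratio. Only the lower estimate is needed: for `s` below the entropy ratio, the cylinders of large
length `n` around the sequence have mass at most `3 ^ (-n * s)`. -/
theorem HasFreqs.eventually_prod_le {τ : Fin 3 → ℝ} {ω : ℕ → Fin 3} (h : HasFreqs τ ω)
    (h0 : ∀ i, 0 ≤ τ i) (h1 : τ 0 + τ 1 + τ 2 = 1) {s : ℝ} (hs : s < entropyRatio τ) :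
    ∀ᶠ n : ℕ in atTop, ∏ k ∈ Finset.range n, τ (ω k) ≤ ((1 / 3 : ℝ) ^ n) ^ s := by
  have hl3 : 0 < Real.log 3 := Real.log_pos (by norm_num)
  rw [entropyRatio_eq h0 h1, lt_div_iff₀ hl3] at hs
  have hsum : ∀ n : ℕ, ∑ k ∈ Finset.range n, Real.log (τ (ω k)) =
      ∑ i, Real.log (τ i) * ∑ k ∈ Finset.range n, if ω k = i then (1 : ℝ) else 0 := by
    intro n
    simp only [Finset.mul_sum]
    rw [Finset.sum_comm]
    refine Finset.sum_congr rfl fun k _ => ?_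
    simp
  have ht : Tendsto (fun n : ℕ => (∑ k ∈ Finset.range n, Real.log (τ (ω k))) / n) atTop
      (𝓝 (-∑ i, Real.negMulLog (τ i))) := by
    have : Tendsto (fun n : ℕ => ∑ i, Real.log (τ i) *
        ((∑ k ∈ Finset.range n, if ω k = i then (1 : ℝ) else 0) / n)) atTop
        (𝓝 (∑ i, Real.log (τ i) * τ i)) :=
      tendsto_finsetSum _ fun i _ => (h i).const_mul _
    have e : -∑ i, Real.negMulLog (τ i) = ∑ i, Real.log (τ i) * τ i := by
      rw [← Finset.sum_neg_distrib]
      refine Finset.sum_congr rfl fun i _ => ?_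
      rw [Real.negMulLog]
      ring
    rw [e]
    refine this.congr fun n => ?_
    rw [hsum, Finset.sum_div]
    exact Finset.sum_congr rfl fun i _ => by ring
  filter_upwards [ht.eventually_lt_const (neg_lt_neg hs), eventually_gt_atTop 0] with n hn hn0
  rw [div_lt_iff₀ (by positivity)] at hn
  -- `t ≤ exp (log t)` also holds for `t = 0`, so vanishing weights need no separate treatment
  calc ∏ k ∈ Finset.range n, τ (ω k)
      ≤ ∏ k ∈ Finset.range n, Real.exp (Real.log (τ (ω k))) :=
        Finset.prod_le_prod (fun k _ => h0 _) fun k _ => Real.le_exp_log _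
    _ = Real.exp (∑ k ∈ Finset.range n, Real.log (τ (ω k))) := (Real.exp_sum _ _).symm
    _ ≤ Real.exp (-(s * Real.log 3) * n) := Real.exp_le_exp.2 hn.le
    _ = ((1 / 3 : ℝ) ^ n) ^ s := by
        rw [Real.rpow_def_of_pos (by positivity), Real.log_pow, one_div, Real.log_inv]
        ring_nf

/-- A set of diameter at most `3 ^ (-n)` meets at most three of the intervals
`[K / 3 ^ n, (K + 1) / 3 ^ n)`, and the digit sequences in `A` of the points of one such interval
lie in one cylinder of length `n`. -/
theorem measure_preimage_inter_le (P : Measure (ℕ → Fin 3)) {A : Set (ℕ → Fin 3)} {n : ℕ}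
    {b : ENNReal} (hA : ∀ ω ∈ A, ∀ N, ∃ k, N ≤ k ∧ ω k ≠ 2)
    (hb : ∀ ω ∈ A, P {ω' | ∀ k < n, ω' k = ω k} ≤ b) {U : Set ℝ}
    (hU : ∀ x ∈ U, ∀ y ∈ U, |x - y| ≤ (1 / 3 : ℝ) ^ n) :
    P (Real.ofDigits ⁻¹' U ∩ A) ≤ 3 * b := by
  rcases (Real.ofDigits ⁻¹' U ∩ A).eq_empty_or_nonempty with he | ⟨ω₀, hω₀U, hω₀A⟩
  · simp [he]
  set F : (ℕ → Fin 3) → ℕ := fun ω => ⌊Real.ofDigits ω * (3 : ℝ) ^ n⌋₊ with hF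
  have hp : (0 : ℝ) < 3 ^ n := by positivity
  have hnn : ∀ ω : ℕ → Fin 3, 0 ≤ Real.ofDigits ω * (3 : ℝ) ^ n := fun ω =>
    mul_nonneg (Real.ofDigits_nonneg _) hp.le
  have hsub : Real.ofDigits ⁻¹' U ∩ A ⊆
      ⋃ K ∈ Finset.Icc (F ω₀ - 1) (F ω₀ + 1), A ∩ {ω | F ω = K} := by
    rintro ω ⟨hωU, hωA⟩
    simp only [mem_iUnion]
    refine ⟨F ω, ?_, hωA, rfl⟩
    have hd := hU _ hωU _ hω₀U
    rw [one_div_pow, le_div_iff₀ hp, ← abs_of_pos hp, ← abs_mul, sub_mul, abs_le] at hd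
    have a1 := Nat.floor_le (hnn ω)
    have a2 := Nat.lt_floor_add_one (Real.ofDigits ω * (3 : ℝ) ^ n)
    have b1 := Nat.floor_le (hnn ω₀)
    have b2 := Nat.lt_floor_add_one (Real.ofDigits ω₀ * (3 : ℝ) ^ n)
    have c1 : ((F ω : ℕ) : ℝ) < F ω₀ + 1 + 1 := by simp only [hF]; linarith
    have c2 : ((F ω₀ : ℕ) : ℝ) < F ω + 1 + 1 := by simp only [hF]; linarith
    have c1' : F ω < F ω₀ + 1 + 1 := by exact_mod_cast c1
    have c2' : F ω₀ < F ω + 1 + 1 := by exact_mod_cast c2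
    rw [Finset.mem_Icc]
    omega
  have hK : ∀ K, P (A ∩ {ω | F ω = K}) ≤ b := by
    intro K
    rcases (A ∩ {ω | F ω = K}).eq_empty_or_nonempty with he | ⟨ω₁, hω₁A, hω₁⟩
    · simp [he]
    refine (measure_mono ?_).trans (hb ω₁ hω₁A)
    rintro ω ⟨hωA, hω⟩ k hk
    have := digits_eq_of_floor_eq (hω.trans hω₁.symm) hk
    rwa [digits_ofDigits (hA ω hωA), digits_ofDigits (hA ω₁ hω₁A)] at this
  refine (measure_mono hsub).trans ((measure_biUnion_finset_le _ _).trans ?_)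
  refine (Finset.sum_le_card_nsmul _ _ b fun K _ => hK K).trans ?_
  rw [nsmul_eq_mul]
  refine mul_le_mul_left ?_ b
  have : (Finset.Icc (F ω₀ - 1) (F ω₀ + 1)).card ≤ 3 := by
    rw [Nat.card_Icc]
    omega
  exact_mod_cast this

/-- The mass distribution principle for a measure on digit sequences that gives cylinders of length
`n ≥ N` around points of `A` mass at most `3 ^ (-n * s)`. -/
theorem hausdorffMeasure_ne_zero_of_cylinder_le (P : Measure (ℕ → Fin 3)) {A : Set (ℕ → Fin 3)}
    {M : Set ℝ} {s : ℝ} (hs : 0 < s) (N : ℕ) (hA : ∀ ω ∈ A, ∀ N, ∃ k, N ≤ k ∧ ω k ≠ 2)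
    (hb : ∀ n ≥ N, ∀ ω ∈ A,
      P {ω' | ∀ k < n, ω' k = ω k} ≤ ENNReal.ofReal (((1 / 3 : ℝ) ^ n) ^ s))
    (hAM : A ⊆ Real.ofDigits ⁻¹' M) (hPA : P A ≠ 0) : μH[s] M ≠ 0 := by
  have hmeas : Measurable (Real.ofDigits (b := 3)) := Real.continuous_ofDigits.measurable
  set ν : Measure ℝ := (P.restrict A).map Real.ofDigits with hν
  have hC : (0 : ℝ) < 3 * 3 ^ s := by positivity
  have key : ∀ U : Set ℝ, Metric.ediam U ≤ ENNReal.ofReal ((1 / 3) ^ N) →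
      ν U ≤ ENNReal.ofReal (3 * 3 ^ s) * Metric.ediam U ^ s := by
    intro U hU
    -- the closure of `U` is measurable and has the same diameter
    refine (measure_mono subset_closure).trans ?_
    rw [← Metric.ediam_closure] at hU ⊢
    rw [hν, Measure.map_apply hmeas isClosed_closure.measurableSet,
      Measure.restrict_apply (hmeas isClosed_closure.measurableSet)]
    set V := closure U
    have hbdd : Bornology.IsBounded V := by
      rw [Metric.isBounded_iff_ediam_ne_top]
      exact ne_top_of_le_ne_top ENNReal.ofReal_ne_top hU
    have hdist : ∀ n : ℕ, Metric.diam V ≤ (1 / 3 : ℝ) ^ n →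
        ∀ x ∈ V, ∀ y ∈ V, |x - y| ≤ (1 / 3 : ℝ) ^ n := fun n hn x hx y hy =>
      (Metric.dist_le_diam_of_mem hbdd hx hy).trans hn
    have hdN : Metric.diam V ≤ (1 / 3 : ℝ) ^ N := ENNReal.toReal_le_of_le_ofReal (by positivity) hU
    have hed : Metric.ediam V = ENNReal.ofReal (Metric.diam V) :=
      (ENNReal.ofReal_toReal (ne_top_of_le_ne_top ENNReal.ofReal_ne_top hU)).symm
    rw [hed, ENNReal.ofReal_rpow_of_nonneg Metric.diam_nonneg hs.le,
      ← ENNReal.ofReal_mul hC.le]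
    have h3 : (3 : ENNReal) = ENNReal.ofReal 3 := by simp
    -- if `V` is a point, let `n → ∞`; otherwise take `n` with
    -- `3 ^ (-(n + 1)) < diam V ≤ 3 ^ (-n)`, which costs the factor `3 ^ s`
    rcases (Metric.diam_nonneg (s := V)).eq_or_lt with hd | hd
    · have hlim : Tendsto (fun n : ℕ => 3 * ENNReal.ofReal (((1 / 3 : ℝ) ^ n) ^ s)) atTop
          (𝓝 0) := by
        have h1 : Tendsto (fun n : ℕ => ((1 / 3 : ℝ) ^ n) ^ s) atTop (𝓝 0) := by
          have := (tendsto_pow_atTop_nhds_zero_of_lt_one (r := (1 / 3 : ℝ)) (by norm_num)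
            (by norm_num)).rpow_const (p := s) (Or.inr hs.le)
          rwa [Real.zero_rpow hs.ne'] at this
        have h2 := ENNReal.tendsto_ofReal h1
        have := ENNReal.Tendsto.const_mul (a := 3) h2 (Or.inr (by simp))
        simpa using this
      refine le_trans (ge_of_tendsto hlim ?_) zero_le
      filter_upwards [eventually_ge_atTop N] with n hn
      exact measure_preimage_inter_le P hA (hb n hn) (hdist n (hd ▸ by positivity))
    · obtain ⟨n, hn1, hn2⟩ := exists_nat_pow_near_of_lt_one hd
        (hdN.trans (pow_le_one₀ (by norm_num) (by norm_num))) (show (0 : ℝ) < 1 / 3 by norm_num)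
        (by norm_num)
      have hnN : N ≤ n := by
        have := (pow_lt_pow_iff_right_of_lt_one₀ (by norm_num) (by norm_num)).1
          (hn1.trans_le hdN)
        omega
      refine (measure_preimage_inter_le P hA (hb n hnN) (hdist n hn2)).trans ?_
      rw [h3, ← ENNReal.ofReal_mul (by norm_num)]
      refine ENNReal.ofReal_le_ofReal ?_
      rw [mul_assoc]
      refine mul_le_mul_of_nonneg_left ?_ (by norm_num)
      rw [← Real.mul_rpow (by norm_num) hd.le]
      refine Real.rpow_le_rpow (by positivity) ?_ hs.le
      rw [pow_succ] at hn1
      linarith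
  have hC0 : ENNReal.ofReal (3 * 3 ^ s) ≠ 0 := by
    rw [Ne, ENNReal.ofReal_eq_zero]
    exact not_le.2 hC
  have hle : (ENNReal.ofReal (3 * 3 ^ s))⁻¹ • ν ≤ μH[s] := by
    refine Measure.le_hausdorffMeasure s _ (ENNReal.ofReal ((1 / 3) ^ N)) ?_ fun U hU => ?_
    · rw [ENNReal.ofReal_pos]
      positivity
    · rw [Measure.smul_apply, smul_eq_mul, ENNReal.inv_mul_le_iff hC0 ENNReal.ofReal_ne_top]
      exact key U hU
  intro hM
  have h1 := hle M
  rw [hM, Measure.smul_apply, smul_eq_mul, nonpos_iff_eq_zero, mul_eq_zero] at h1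
  rcases h1 with h1 | h1
  · exact ENNReal.ofReal_ne_top (ENNReal.inv_eq_zero.1 h1)
  · have h2 : P.restrict A (Real.ofDigits ⁻¹' M) ≤ ν M :=
      Measure.le_map_apply hmeas.aemeasurable M
    have h3 : P (Real.ofDigits ⁻¹' M ∩ A) ≤ P.restrict A (Real.ofDigits ⁻¹' M) :=
      Measure.le_restrict_apply _ _
    rw [inter_eq_self_of_subset_right hAM] at h3
    exact hPA (le_antisymm ((h3.trans h2).trans h1.le) zero_le)

/-- The Bernoulli measure with weights `τ` is carried by the codes of points of `M₀`. For `b` below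
the entropy ratio, some set `A N` on which the cylinder bound with exponent `b` holds from length
`N` on has positive measure, and the mass distribution principle applies to it. -/
theorem ofReal_entropyRatio_le_dimH {τ : Fin 3 → ℝ} (hτ : τ ∈ freqLine) :
    ENNReal.ofReal (entropyRatio τ) ≤ dimH M₀ := by
  have := isProbabilityMeasure_digitLaw hτ.1 hτ.2.1
  have hprob : IsProbabilityMeasure (bernoulli τ) := by unfold bernoulli; infer_instance
  refine le_of_forall_lt fun a ha => ?_
  obtain ⟨b, hab, hb⟩ := exists_between ha
  refine hab.trans_le ?_
  lift b to NNReal using ne_top_of_lt hb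
  have hb0 : (0 : ℝ) < b := by
    have := pos_of_gt hab
    exact_mod_cast this
  have hbτ : (b : ℝ) < entropyRatio τ := by
    rw [ENNReal.lt_ofReal_iff_toReal_lt ENNReal.coe_ne_top] at hb
    exact hb
  set A : ℕ → Set (ℕ → Fin 3) := fun N => {ω | HasFreqs τ ω ∧ ∀ n ≥ N,
    ∏ k ∈ Finset.range n, τ (ω k) ≤ ((1 / 3 : ℝ) ^ n) ^ (b : ℝ)} with hA
  have hU : bernoulli τ (⋃ N, A N) ≠ 0 := by
    have : ∀ᵐ ω ∂bernoulli τ, ω ∈ ⋃ N, A N := by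
      filter_upwards [ae_hasFreqs hτ.1] with ω hω
      obtain ⟨N, hN⟩ := eventually_atTop.1 (hω.eventually_prod_le hτ.1 hτ.2.1 hbτ)
      exact mem_iUnion.2 ⟨N, hω, hN⟩
    intro hnull
    obtain ⟨ω, hω, hω'⟩ := (this.and (measure_eq_zero_iff_ae_notMem.1 hnull)).exists
    exact hω' hω
  obtain ⟨N, hN⟩ := exists_measure_pos_of_not_measure_iUnion_null hU
  refine le_dimH_of_hausdorffMeasure_ne_zero ?_
  refine hausdorffMeasure_ne_zero_of_cylinder_le (bernoulli τ) hb0 N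
    (fun ω hω => hω.1.exists_ne_two (pos_of_mem_freqLine hτ)) (fun n hn ω hω => ?_)
    (fun ω hω => hω.1.ofDigits_mem_M₀ hτ) hN.ne'
  rw [bernoulli_cylinder hτ.1]
  exact ENNReal.ofReal_le_ofReal (hω.2 n hn)

/-! ### The maximum of the entropy ratio -/

theorem isCompact_freqLine : IsCompact freqLine := by
  refine (isCompact_Icc (a := (0 : Fin 3 → ℝ)) (b := 1)).of_isClosed_subset ?_ ?_
  · have e : freqLine = (⋂ i, {τ | 0 ≤ τ i}) ∩
        ({τ | τ 0 + τ 1 + τ 2 = 1} ∩ {τ | 2 * τ 1 + 3 * τ 2 = 1}) := by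
      ext τ
      simp [freqLine]
    rw [e]
    refine IsClosed.inter ?_ (IsClosed.inter ?_ ?_)
    · exact isClosed_iInter fun i => isClosed_le continuous_const (continuous_apply i)
    · exact isClosed_eq (by fun_prop) continuous_const
    · exact isClosed_eq (by fun_prop) continuous_const
  · rintro τ ⟨h0, h1, -⟩
    refine ⟨h0, fun i => ?_⟩
    have := h0 0
    have := h0 1
    have := h0 2
    fin_cases i <;> simp <;> linarith

theorem continuousOn_entropyRatio : ContinuousOn entropyRatio freqLine := by
  have h : Continuous fun τ : Fin 3 → ℝ => (∑ i, Real.negMulLog (τ i)) / Real.log 3 := by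
    fun_prop
  exact h.continuousOn.congr fun τ hτ => entropyRatio_eq hτ.1 hτ.2.1

theorem rationalPoint_mem_freqLine : (![7 / 12, 1 / 4, 1 / 6] : Fin 3 → ℝ) ∈ freqLine := by
  refine ⟨fun i => ?_, ?_, ?_⟩
  · fin_cases i <;> norm_num
  · simp; norm_num
  · simp; norm_num

set_option exponentiation.threshold 1000 in
theorem lt_entropyRatio_rationalPoint :
    (69 / 79 : ℝ) < entropyRatio ![7 / 12, 1 / 4, 1 / 6] := by
  have hl3 : 0 < Real.log 3 := Real.log_pos (by norm_num)
  rw [entropyRatio_eq rationalPoint_mem_freqLine.1 rationalPoint_mem_freqLine.2.1,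
    lt_div_iff₀ hl3]
  -- with `τ = (7/12, 1/4, 1/6)` and `828 = 12 * 69`, exponentiating `12 * 79 * H(τ) > 828 * log 3`
  -- leaves a comparison of rational numbers
  have key : Real.log ((3 : ℝ) ^ 828) <
      Real.log (((12 / 7 : ℝ) ^ 7 * 4 ^ 3 * 6 ^ 2) ^ 79) :=
    Real.log_lt_log (by positivity) (by norm_num)
  rw [Real.log_pow, Real.log_pow, Real.log_mul (by norm_num) (by norm_num),
    Real.log_mul (by norm_num) (by norm_num), Real.log_pow, Real.log_pow, Real.log_pow] at key
  have e : ∑ i, Real.negMulLog ((![7 / 12, 1 / 4, 1 / 6] : Fin 3 → ℝ) i) =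
      7 / 12 * Real.log (12 / 7) + 1 / 4 * Real.log 4 + 1 / 6 * Real.log 6 := by
    rw [show (12 / 7 : ℝ) = (7 / 12)⁻¹ by norm_num, show (4 : ℝ) = (1 / 4)⁻¹ by norm_num,
      show (6 : ℝ) = (1 / 6)⁻¹ by norm_num, Real.log_inv, Real.log_inv, Real.log_inv]
    simp [Fin.sum_univ_three, Real.negMulLog]
    ring
  rw [e]
  push_cast at key
  linarith

/-- The tangent-line inequality `log y ≤ y - 1` at `y = q / t`. -/
theorem negMulLog_le {t q : ℝ} (ht : 0 ≤ t) (hq : 0 < q) :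
    Real.negMulLog t ≤ -(t * Real.log q) + q - t := by
  rcases ht.eq_or_lt with rfl | h
  · simpa using hq.le
  · have := mul_le_mul_of_nonneg_left (Real.log_le_sub_one_of_pos (div_pos hq h)) ht
    rw [Real.log_div hq.ne' h.ne', mul_sub, mul_sub, mul_div_cancel₀ _ h.ne'] at this
    rw [Real.negMulLog]
    linarith

/-- Gibbs' inequality against the weights proportional to `1, z ^ 2, z ^ 3`, whose logarithms are
constant on average along the line `2 τ₁ + 3 τ₂ = 1`. -/
theorem sum_negMulLog_le {τ : Fin 3 → ℝ} (hτ : τ ∈ freqLine) {z : ℝ} (hz : 0 < z) :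
    ∑ i, Real.negMulLog (τ i) ≤ Real.log ((1 + z ^ 2 + z ^ 3) / z) := by
  obtain ⟨h0, h1, h2⟩ := hτ
  set S := 1 + z ^ 2 + z ^ 3 with hS
  have hS0 : 0 < S := by positivity
  have a0 := negMulLog_le (h0 0) (div_pos one_pos hS0)
  have a1 := negMulLog_le (h0 1) (div_pos (pow_pos hz 2) hS0)
  have a2 := negMulLog_le (h0 2) (div_pos (pow_pos hz 3) hS0)
  rw [Real.log_div (by positivity) hS0.ne'] at a0 a1 a2
  rw [Real.log_one] at a0
  rw [Real.log_pow] at a1 a2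
  push_cast at a1 a2
  have e : 1 / S + z ^ 2 / S + z ^ 3 / S = 1 := by
    rw [← add_div, ← add_div, div_self hS0.ne']
  rw [Fin.sum_univ_three, Real.log_div hS0.ne' hz.ne']
  have e1 : τ 0 * Real.log S + τ 1 * Real.log S + τ 2 * Real.log S = Real.log S := by
    rw [← add_mul, ← add_mul, h1, one_mul]
  have e2 : 2 * (τ 1 * Real.log z) + 3 * (τ 2 * Real.log z) = Real.log z := by
    rw [← mul_assoc, ← mul_assoc, ← add_mul, h2, one_mul]
  linarith

theorem entropyRatio_lt {τ : Fin 3 → ℝ} (hτ : τ ∈ freqLine) : entropyRatio τ < 145 / 166 := by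
  have hl3 : 0 < Real.log 3 := Real.log_pos (by norm_num)
  rw [entropyRatio_eq hτ.1 hτ.2.1, div_lt_iff₀ hl3]
  -- `z = 21 / 32` is close to the minimiser of `(1 + z ^ 2 + z ^ 3) / z`
  refine (sum_negMulLog_le hτ (show (0 : ℝ) < 21 / 32 by norm_num)).trans_lt ?_
  have key : Real.log (((1 + (21 / 32 : ℝ) ^ 2 + (21 / 32) ^ 3) / (21 / 32)) ^ 166) <
      Real.log ((3 : ℝ) ^ 145) := Real.log_lt_log (by positivity) (by norm_num)
  rw [Real.log_pow, Real.log_pow] at key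
  push_cast at key
  linarith

end AsymptoticMean

open AsymptoticMean in
theorem mainTheorem2 :
    AsymptoticMean.M₀ = {x : ℝ | x ∈ Set.Icc (0 : ℝ) 1 ∧ ∃ v₁ v₂ : ℝ,
        AsymptoticMean.HasFreq 1 x v₁ ∧ AsymptoticMean.HasFreq 2 x v₂ ∧ 2 * v₁ + 3 * v₂ = 1} ∧
    Cardinal.mk AsymptoticMean.M₀ = Cardinal.continuum ∧
    Set.Icc (0 : ℝ) 1 ⊆ closure AsymptoticMean.M₀ ∧
    MeasureTheory.volume AsymptoticMean.M₀ = 0 ∧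
    (∃ D : ℝ, IsGreatest (AsymptoticMean.entropyRatio '' AsymptoticMean.freqLine) D ∧
      0.8734 < D ∧ D < 0.8735 ∧ ENNReal.ofReal D ≤ dimH AsymptoticMean.M₀) ∧
    ENNReal.ofReal 0.87 ≤ dimH AsymptoticMean.M₀ := by
  obtain ⟨τ, hτ, hmax⟩ := isCompact_freqLine.exists_isMaxOn ⟨_, rationalPoint_mem_freqLine⟩
    continuousOn_entropyRatio
  have hlow : (0.8734 : ℝ) < entropyRatio τ := by
    have h := lt_entropyRatio_rationalPoint.trans_le (hmax rationalPoint_mem_freqLine)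
    refine lt_trans ?_ h
    norm_num
  have hdim := ofReal_entropyRatio_le_dimH hτ
  have hdim' : ENNReal.ofReal 0.87 ≤ dimH M₀ :=
    (ENNReal.ofReal_le_ofReal (by linarith)).trans hdim
  have hcount : ¬ M₀.Countable := fun h => by
    rw [h.dimH_zero, nonpos_iff_eq_zero, ENNReal.ofReal_eq_zero] at hdim'
    norm_num at hdim'
  refine ⟨Set.ext fun x => mem_M₀_iff, mk_eq_continuum_of_not_countable measurableSet_M₀ hcount,
    Icc_subset_closure_M₀ ?_, volume_M₀, ⟨entropyRatio τ, ⟨⟨τ, hτ, rfl⟩, ?_⟩, hlow, ?_, hdim⟩,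
    hdim'⟩
  · by_contra h
    exact hcount (Set.not_nonempty_iff_eq_empty.1 h ▸ Set.countable_empty)
  · rintro _ ⟨σ, hσ, rfl⟩
    exact hmax hσ
  · exact (entropyRatio_lt hτ).trans (by norm_num)
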